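/- Let $(a_{ij})_{i,j\in I}$ be an affine Cartan matrix, i.e. a generalized Cartan matrix of corank $1$ all of whose proper principal submatrices are positive definite (after symmetrization). Let $W_{af}$ be its affine Weyl group, generated by the $s_i$ ($i\in I$) subject to $s_i^2=1$ and $(s_is_j)^{m_{ij}}=1$ for $i\neq j$, where $m_{ij}=2,3,4,6,\infty$ for $a_{ij}a_{ji}=0,1,2,3,4$ (no relation if $m_{ij}=\infty$), with length function $\ell$. It acts on the affine root lattice $\bigoplus_{i\in I}\mathbb{Z}\alpha_i$ by $s_i\cdot\mu=\mu-\langle\alpha_i^\vee,\mu\rangle\alpha_i$, where $\langle\alpha_i^\vee,\alpha_j\rangle=a_{ij}$. Let $R_{af}=\{w\cdot\alpha_i\mid w\in W_{af},\ i\in I\}$ be the set of affine roots; for $\beta=u\cdot\alpha_i\in R_{af}$ let $s_\beta=us_iu^{-1}\in W_{af}$. Identify the alcove $w\mathbf{a}_0$ with $w\in W_{af}$, where $\mathbf{a}_0$ is the base alcove. An alcove walk $\gamma$ of length $m$ to $w$ (not necessarily minimal) is a sequence $1=u_0,u_1,\dots,u_m=w$ in $W_{af}$ together with $i_1,\dots,i_m\in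 I$ such that $u_j=u_{j-1}s_{i_j}$ for all $j$. Its $j$-th step crosses the hyperplane of the root $u_{j-1}\cdot\alpha_{i_j}$, and is indexed by the root $\beta_j\in\{\pm u_{j-1}\cdot\alpha_{i_j}\}$ which is positive if $\ell(u_{j-1})<\ell(u_j)$ and negative otherwise. For a mask $\varepsilon\in\{0,1\}^m$ put $w^\varepsilon=s_{i_1}^{\varepsilon_1}\cdots s_{i_m}^{\varepsilon_m}$, $|\varepsilon|=\sum_j\varepsilon_j$ and $\Psi_\gamma^\varepsilon=\prod_{\varepsilon_j=1}\beta_j\in\mathbb{Z}[\alpha_i\mid i\in I]$. For $v,w\in W_{af}$ define $$\psi^v(w)=\sum_{|\varepsilon|=\ell(v),\ w^\varepsilon=v}\Psi_\gamma^\varepsilon,$$ where $\gamma$ is any alcove walk to $w$. Then $\psi^v(w)$ does not depend on the choice of $\gamma$, and for every $v\in W_{af}$ the function $\psi^v$ satisfies the GKM condition: for all $w\in W_{af}$ and all $\beta\in R_{af}$, $$\beta\ \big|\ \psi^v(w)-\psi^v(s_\beta w)\quad\text{in } \mathbb{Z}[\alpha_i\mid i\in I].$$ -/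

import Mathlib

open scoped BigOperators

/-- An affine Cartan datum on a finite index set `I`: a generalized Cartan matrix of corank `1`,
all of whose proper principal submatrices are positive definite. As Cartan matrices need not be
symmetric, positive definiteness is (as usual) that of a symmetrization `diag(d) * A_J` with
positive `d`. -/
structure AffineCartanDatum (I : Type*) [Fintype I] [DecidableEq I] where
  /-- The matrix `(a_ij)`. -/
  A : Matrix I I ℤ
  diag : ∀ i, A i i = 2
  off_diag_nonpos : ∀ i j, i ≠ j → A i j ≤ 0
  ne_zero_iff : ∀ i j, A i j ≠ 0 ↔ A j i ≠ 0
  corank_one : (A.map (fun a : ℤ => (a : ℝ))).rank + 1 = Fintype.card I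
  proper_posDef : ∀ J : Finset I, J ≠ Finset.univ →
    ∃ d : J → ℝ, (∀ j, 0 < d j) ∧
      (Matrix.diagonal d * Matrix.of (fun i j : J => ((A i j : ℤ) : ℝ))).PosDef

/-- The order `m` of a product of two distinct simple reflections as a function of
`p = a_ij * a_ji`. The value `0` stands for "no relation" (`m = ∞`); it occurs for `p = 4`,
that is, only in the two affine types with two nodes. -/
def coxeterOrder (p : ℤ) : ℕ :=
  if p = 0 then 2 else if p = 1 then 3 else if p = 2 then 4 else if p = 3 then 6 else 0

theorem coxeterOrder_ne_one (p : ℤ) : coxeterOrder p ≠ 1 := by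
  unfold coxeterOrder
  split_ifs <;> norm_num

namespace AffineCartanDatum

section

variable {I : Type*} [Fintype I] [DecidableEq I] (D : AffineCartanDatum I)

/-- The Coxeter matrix `(m_ij)` of the affine Cartan datum. -/
def coxeterMatrix : CoxeterMatrix I where
  M := Matrix.of fun i j => if i = j then 1 else coxeterOrder (D.A i j * D.A j i)
  isSymm := by
    ext i j
    simp only [Matrix.transpose_apply, Matrix.of_apply, eq_comm (a := j), mul_comm (D.A j i)]
  diagonal i := by simp
  off_diagonal i j h := by
    simp only [Matrix.of_apply, if_neg h]
    exact coxeterOrder_ne_one _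

/-- The affine Weyl group `W_af`: generators `s_i`, `i ∈ I`, with relations `s_i ^ 2 = 1` and
`(s_i * s_j) ^ m_ij = 1`. -/
abbrev Weyl : Type _ := D.coxeterMatrix.Group

/-- `W_af` with its simple reflections, as a Coxeter system. -/
abbrev cs : CoxeterSystem D.coxeterMatrix D.Weyl := D.coxeterMatrix.toCoxeterSystem

/-- The simple reflection `s_i ∈ W_af`. -/
def s (i : I) : D.Weyl := D.cs.simple i

/-- The simple affine root `α_i` in the affine root lattice `⨁ i, ℤ α_i`, whose elements are
written as coordinate vectors `I → ℤ`. -/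
def simpleRoot (_D : AffineCartanDatum I) (i : I) : I → ℤ := Pi.single i 1

/-- The pairing `⟨α_i^∨, μ⟩`, determined by `⟨α_i^∨, α_j⟩ = a_ij`. -/
def corootPairing (i : I) : (I → ℤ) →ₗ[ℤ] ℤ := ∑ j, D.A i j • LinearMap.proj j

theorem corootPairing_simpleRoot (i j : I) : D.corootPairing i (D.simpleRoot j) = D.A i j := by
  simp [corootPairing, simpleRoot, Pi.single_apply]

/-- `s_i · μ = μ - ⟨α_i^∨, μ⟩ α_i` on the affine root lattice. -/
def simpleReflectionEnd (i : I) : Module.End ℤ (I → ℤ) :=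
  LinearMap.id - (D.corootPairing i).smulRight (D.simpleRoot i)

theorem simpleReflectionEnd_apply (i : I) (μ : I → ℤ) :
    D.simpleReflectionEnd i μ = μ - D.corootPairing i μ • D.simpleRoot i := by
  simp [simpleReflectionEnd]

/-- The endomorphisms above satisfy the defining relations of `W_af`. -/
theorem simpleReflectionEnd_isLiftable :
    D.coxeterMatrix.IsLiftable D.simpleReflectionEnd := by
  intro i j
  by_cases hij : i = j
  · subst hij
    have hM : D.coxeterMatrix i i = 1 := D.coxeterMatrix.diagonal i
    rw [hM, pow_one]
    refine LinearMap.ext fun μ => ?_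
    simp only [Module.End.mul_apply, simpleReflectionEnd_apply, map_sub, map_smul,
      corootPairing_simpleRoot, D.diag, Module.End.one_apply]
    module
  have hM : D.coxeterMatrix i j = coxeterOrder (D.A i j * D.A j i) := if_neg hij
  -- one application of `s_i s_j`
  have key : ∀ μ : I → ℤ, (D.simpleReflectionEnd i * D.simpleReflectionEnd j) μ =
      μ - (D.corootPairing i μ - D.A i j * D.corootPairing j μ) • D.simpleRoot i
        - D.corootPairing j μ • D.simpleRoot j := by
    intro μ
    simp only [Module.End.mul_apply, simpleReflectionEnd_apply, map_sub, map_smul,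
      corootPairing_simpleRoot]
    module
  have hx : ∀ μ : I → ℤ,
      D.corootPairing i ((D.simpleReflectionEnd i * D.simpleReflectionEnd j) μ) =
        -D.corootPairing i μ + D.A i j * D.corootPairing j μ := by
    intro μ
    rw [key]
    simp only [map_sub, map_smul, corootPairing_simpleRoot, D.diag, smul_eq_mul]
    ring
  have hy : ∀ μ : I → ℤ,
      D.corootPairing j ((D.simpleReflectionEnd i * D.simpleReflectionEnd j) μ) =
        -(D.A j i * D.corootPairing i μ) + (D.A i j * D.A j i - 1) * D.corootPairing j μ := by
    intro μ
    rw [key]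
    simp only [map_sub, map_smul, corootPairing_simpleRoot, D.diag, smul_eq_mul]
    ring
  rw [hM]
  generalize hT : D.simpleReflectionEnd i * D.simpleReflectionEnd j = T at key hx hy ⊢
  generalize D.corootPairing i = f at key hx hy
  generalize D.corootPairing j = g at key hx hy
  have h0 := D.ne_zero_iff i j
  generalize D.A i j = p at key hx hy h0 ⊢
  generalize D.A j i = q at key hx hy h0 ⊢
  unfold coxeterOrder
  split_ifs with h h h h
  · have hp : p = 0 := by
      rcases mul_eq_zero.mp h with hp | hq
      · exact hp
      · by_contra hp
        exact h0.mp hp hq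
    have hq : q = 0 := by
      by_contra hq
      exact h0.mpr hq hp
    subst hp hq
    refine LinearMap.ext fun μ => ?_
    simp only [pow_succ, pow_zero, one_mul, Module.End.mul_apply, Module.End.one_apply]
    rw [key (T μ), hx, hy, key μ]
    module
  all_goals
    have key3 : ∀ μ : I → ℤ, T (T (T μ)) =
        (p * q - 1) • T (T μ) - (p * q - 1) • T μ + μ := by
      intro μ
      rw [key (T (T μ)), hx (T μ), hy (T μ), hx μ, hy μ, key (T μ), hx μ, hy μ, key μ]
      module
    refine LinearMap.ext fun μ => ?_
    try simp only [h] at key3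
    simp only [pow_succ, pow_zero, one_mul, Module.End.mul_apply, Module.End.one_apply, key3,
      map_add, map_sub, map_smul]
    try module

/-- The action of `W_af` on the affine root lattice, extending
`s_i · μ = μ - ⟨α_i^∨, μ⟩ α_i`. -/
def act : D.Weyl →* Module.End ℤ (I → ℤ) :=
  D.cs.lift ⟨D.simpleReflectionEnd, D.simpleReflectionEnd_isLiftable⟩

theorem act_s (i : I) (μ : I → ℤ) :
    D.act (D.s i) μ = μ - D.corootPairing i μ • D.simpleRoot i := by
  rw [← simpleReflectionEnd_apply]
  exact congrArg (fun f : Module.End ℤ (I → ℤ) => f μ)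
    (D.cs.lift_apply_simple D.simpleReflectionEnd_isLiftable i)

/-- The (real) affine roots `R_af = {w · α_i}`. -/
def roots : Set (I → ℤ) := {β | ∃ (w : D.Weyl) (i : I), β = D.act w (D.simpleRoot i)}

/-- `t = s_β`: the reflection attached to the affine root `β = u · α_i` is the element
`u * s_i * u⁻¹` of `W_af`. -/
def IsRootReflection (β : I → ℤ) (t : D.Weyl) : Prop :=
  ∃ (u : D.Weyl) (i : I), β = D.act u (D.simpleRoot i) ∧ t = u * D.s i * u⁻¹

open Classical in
/-- The one of `±β` with nonnegative coordinates (for an affine root `β`). -/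
noncomputable def rootPos (β : I → ℤ) : I → ℤ := if 0 ≤ β then β else -β

/-- The negative one of `±β`. -/
noncomputable def rootNeg (β : I → ℤ) : I → ℤ := -rootPos β

/-- A lattice element `∑ β_i α_i`, viewed as a linear form in the polynomial ring
`ℤ[α_i : i ∈ I]`. -/
noncomputable def rootPoly (β : I → ℤ) : MvPolynomial I ℤ :=
  ∑ i, MvPolynomial.C (β i) * MvPolynomial.X i

/-- An (unfolded) alcove walk `(a_0, a_1, …, a_m)` starting in the base alcove. The alcove `w a_0`
is identified with `w ∈ W_af`; the `j`-th step goes from an alcove `u` to the alcove `u * s_i` on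
the other side of its panel of type `i = panel j`. Walks need not be of minimal length. -/
structure AlcoveWalk where
  /-- The number `m` of steps. -/
  len : ℕ
  /-- The alcoves `a_0, …, a_m`. -/
  alcove : Fin (len + 1) → D.Weyl
  /-- The types of the panels crossed. -/
  panel : Fin len → I
  start : alcove 0 = 1
  step : ∀ j : Fin len, alcove j.succ = alcove j.castSucc * D.s (panel j)

namespace AlcoveWalk

variable {D} (γ : D.AlcoveWalk)

/-- The final alcove of the walk. -/
def target : D.Weyl := γ.alcove (Fin.last γ.len)

/-- The affine root indexing the crossing at step `j`: the wall between `u` and `u * s_i` is the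
hyperplane of `u · α_i`, and it is indexed by its positive root if the step is forward (increases
the length) and by its negative root if the step is backward. -/
noncomputable def crossing (j : Fin γ.len) : I → ℤ :=
  if D.cs.length (γ.alcove j.castSucc) < D.cs.length (γ.alcove j.succ) then
    rootPos (D.act (γ.alcove j.castSucc) (D.simpleRoot (γ.panel j)))
  else
    rootNeg (D.act (γ.alcove j.castSucc) (D.simpleRoot (γ.panel j)))

/-- The subexpression `s_{i_1}^{ε_1} ⋯ s_{i_m}^{ε_m}` picked out by a mask `ε ∈ {0,1}^m`. -/
def subexpr (ε : Fin γ.len → Fin 2) : D.Weyl :=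
  (List.ofFn fun j => D.s (γ.panel j) ^ (ε j : ℕ)).prod

/-- The support `|ε|`: the number of entries equal to `1`. -/
def support (ε : Fin γ.len → Fin 2) : ℕ := (Finset.univ.filter fun j => ε j = 1).card

/-- `Ψ_γ^ε`: the product of the roots indexing the crossings shown by `ε`. -/
noncomputable def Psi (ε : Fin γ.len → Fin 2) : MvPolynomial I ℤ :=
  ∏ j ∈ Finset.univ.filter (fun j => ε j = 1), rootPoly (γ.crossing j)

open Classical in
/-- The sum of `Ψ_γ^ε` over all masks `ε` on `γ` for `v` with `|ε| = ℓ(v)`. -/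
noncomputable def maskSum (v : D.Weyl) : MvPolynomial I ℤ :=
  ∑ ε ∈ Finset.univ.filter
    (fun ε : Fin γ.len → Fin 2 => γ.support ε = D.cs.length v ∧ γ.subexpr ε = v), γ.Psi ε

/-- The trivial walk. -/
def trivial : D.AlcoveWalk where
  len := 0
  alcove := fun _ => 1
  panel := Fin.elim0
  start := rfl
  step := fun j => j.elim0

/-- Extend a walk by a step across the panel of type `i`. -/
def extend (i : I) : D.AlcoveWalk where
  len := γ.len + 1
  alcove := Fin.snoc (α := fun _ => D.Weyl) γ.alcove (γ.target * D.s i)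
  panel := Fin.snoc (α := fun _ => I) γ.panel i
  start := by
    rw [← Fin.castSucc_zero, Fin.snoc_castSucc]
    exact γ.start
  step := by
    intro j
    refine Fin.lastCases ?_ (fun j => ?_) j
    · rw [Fin.succ_last, Fin.snoc_last, Fin.snoc_castSucc, Fin.snoc_last]
      rfl
    · rw [Fin.succ_castSucc, Fin.snoc_castSucc, Fin.snoc_castSucc, Fin.snoc_castSucc]
      exact γ.step j

end AlcoveWalk

/-- Every alcove is the end of some alcove walk. -/
theorem exists_walk (w : D.Weyl) : ∃ γ : D.AlcoveWalk, γ.target = w := by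
  refine D.cs.simple_induction_right (p := fun w => ∃ γ : D.AlcoveWalk, γ.target = w) w ?_ ?_
  · exact ⟨AlcoveWalk.trivial, rfl⟩
  · rintro w i ⟨γ, rfl⟩
    exact ⟨γ.extend i, Fin.snoc_last (α := fun _ => D.Weyl) _ _⟩

/-- The function `ψ^v : W_af → ℤ[α_i : i ∈ I]`: the value at `w` is the mask sum of some alcove
walk to `w`. -/
noncomputable def psi (v w : D.Weyl) : MvPolynomial I ℤ :=
  (D.exists_walk w).choose.maskSum v

/-- The GKM condition for a function `f : W_af → ℤ[α_i : i ∈ I]`. -/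
def SatisfiesGKM (f : D.Weyl → MvPolynomial I ℤ) : Prop :=
  ∀ β ∈ D.roots, ∀ t : D.Weyl, D.IsRootReflection β t →
    ∀ w : D.Weyl, rootPoly β ∣ f w - f (t * w)

end

end AffineCartanDatum

/-!
The proof encodes mask sums in the nil-Coxeter algebra, with basis `x_v` (`v ∈ W_af`) and products
`x_v x_i = x_{v s_i}` if `v s_i` is longer than `v`, and `x_v x_i = 0` otherwise.

For a walk with panel types `i_1, …, i_m` and crossing roots `β_1, …, β_m`, the mask sum at `v` is
the coefficient of `x_v` in `(1 + β_1 x_{i_1}) ⋯ (1 + β_m x_{i_m})`: the condition `|ε| = ℓ(v)`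
selects the masks whose subexpression is reduced (`weightedMaskSum_succ`).

The sign convention for crossings says that `β_j = u_{j-1} · α_{i_j}` for forward and for backward
steps alike (`AlcoveWalk.crossing_eq`). This rests on the theorem that `u · α_i` has nonnegative
coordinates when `u s_i` is longer than `u` (`act_simpleRoot_nonneg`). It is proved by induction on
the length, by splitting off from `u` a maximal alternating suffix in two letters and
computing in the dihedral group which these generate.

Hence a step acts on pairs `(u, φ)` of an alcove and an element of the algebra by
`(u, φ) ↦ (u s_i, φ (1 + (u · α_i) x_i))`. These steps are involutions, and they satisfy the braid
relations of orders 2, 3, 4 and 6, by the Yang-Baxter equations in the nil-Coxeter algebra for the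
root systems `A_1 × A_1`, `A_2`, `B_2` and `G_2`. So they define an action of `W_af` on pairs
(`walkAction`), and the product above depends only on the end of the walk (`walkCoeff`). This is the
independence of the walk.

For the GKM condition let `β = r · α_i` and `t = s_β = r s_i r⁻¹`, and compare two walks, to
`w` and to `t w = r s_i (r⁻¹ w)`. Both begin with a walk to `r`; the second then makes a step of
type `i`, which multiplies by `1 + β x_i ≡ 1` modulo `β`; then both follow the same word for
`r⁻¹ w`, from `r` and from `r s_i = t r`. The crossing roots of these last parts correspond under
`t`, and `t · μ ≡ μ` modulo `β`, so the two products are congruent (`dvd_walkAction_sub`).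
-/

/-! ### Positivity of the roots `u · α_i` -/

namespace AffineCartanDatum

section Positivity

variable {I : Type*} [Fintype I] [DecidableEq I] (D : AffineCartanDatum I)

open CoxeterSystem (alternatingWord)

theorem act_mul_s_simpleRoot (u : D.Weyl) (i j : I) :
    D.act (u * D.s i) (D.simpleRoot j) =
      D.act u (D.simpleRoot j) - D.A i j • D.act u (D.simpleRoot i) := by
  rw [map_mul, Module.End.mul_apply, act_s, corootPairing_simpleRoot, map_sub, map_smul]

theorem act_mul_s_simpleRoot_self (u : D.Weyl) (i : I) :
    D.act (u * D.s i) (D.simpleRoot i) = -D.act u (D.simpleRoot i) := by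
  rw [act_mul_s_simpleRoot, D.diag]
  module

theorem act_s_lin_left (s t : I) (c d : ℤ) :
    D.act (D.s s) (c • D.simpleRoot s + d • D.simpleRoot t) =
      (-c - D.A s t * d) • D.simpleRoot s + d • D.simpleRoot t := by
  simp only [map_add, map_smul, act_s, corootPairing_simpleRoot, D.diag]
  module

theorem act_s_lin_right (s t : I) (c d : ℤ) :
    D.act (D.s t) (c • D.simpleRoot s + d • D.simpleRoot t) =
      c • D.simpleRoot s + (-d - D.A t s * c) • D.simpleRoot t := by
  simp only [map_add, map_smul, act_s, corootPairing_simpleRoot, D.diag]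
  module

theorem coxeterMatrix_apply_of_ne {i j : I} (h : i ≠ j) :
    D.coxeterMatrix i j = coxeterOrder (D.A i j * D.A j i) := if_neg h

theorem act_wordProd_alternatingWord_succ (s t : I) (k : ℕ) (μ : I → ℤ) :
    D.act (D.cs.wordProd (alternatingWord s t (k + 1))) μ =
      D.act (D.s (if Even k then t else s)) (D.act (D.cs.wordProd (alternatingWord s t k)) μ) := by
  rw [CoxeterSystem.alternatingWord_succ', CoxeterSystem.wordProd_cons, map_mul]
  rfl

theorem wordProd_braid (i j : I) :
    D.cs.wordProd (alternatingWord i j (D.coxeterMatrix i j)) =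
      D.cs.wordProd (alternatingWord j i (D.coxeterMatrix i j)) := by
  have hb := D.cs.wordProd_braidWord_eq i j
  rwa [CoxeterSystem.braidWord, CoxeterSystem.braidWord, ← D.coxeterMatrix.symmetric i j] at hb

/-- The pairs of Cartan integers of two distinct nodes, with the orders of the corresponding
dihedral groups (`0` for infinite order). -/
theorem cartan_pair_cases {i j : I} (h : i ≠ j) :
    (D.coxeterMatrix i j = 2 ∧ D.A i j = 0 ∧ D.A j i = 0) ∨
    (D.coxeterMatrix i j = 3 ∧ D.A i j = -1 ∧ D.A j i = -1) ∨
    (D.coxeterMatrix i j = 4 ∧ D.A i j = -1 ∧ D.A j i = -2) ∨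
    (D.coxeterMatrix i j = 4 ∧ D.A i j = -2 ∧ D.A j i = -1) ∨
    (D.coxeterMatrix i j = 6 ∧ D.A i j = -1 ∧ D.A j i = -3) ∨
    (D.coxeterMatrix i j = 6 ∧ D.A i j = -3 ∧ D.A j i = -1) ∨
    (D.coxeterMatrix i j = 0 ∧ 4 ≤ D.A i j * D.A j i) := by
  rw [D.coxeterMatrix_apply_of_ne h]
  have h1 := D.off_diag_nonpos i j h
  have h2 := D.off_diag_nonpos j i h.symm
  have h0 := D.ne_zero_iff i j
  generalize D.A i j = p at *
  generalize D.A j i = q at *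
  by_cases hp : p = 0
  · have hq : q = 0 := by
      by_contra hq
      exact h0.mpr hq hp
    simp [hp, hq, coxeterOrder]
  have hq : q ≠ 0 := h0.mp hp
  by_cases h4 : 4 ≤ p * q
  · refine Or.inr (Or.inr (Or.inr (Or.inr (Or.inr (Or.inr ⟨?_, h4⟩)))))
    unfold coxeterOrder
    split_ifs <;> omega
  · have hp1 : p ≤ -1 := by omega
    have hq1 : q ≤ -1 := by omega
    have hp3 : -3 ≤ p := by nlinarith
    have hq3 : -3 ≤ q := by nlinarith
    interval_cases p <;> interval_cases q <;> simp_all [coxeterOrder]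

/-- In an infinite dihedral parabolic subgroup, the coefficients of the roots obtained from `α_s`
by reflecting alternately in `t` and `s` keep growing: the bound on the coefficient
which the next reflection changes is stronger than its positivity, and is what reproduces. -/
theorem exists_act_alternatingWord_of_four_le {s t : I} (hst : s ≠ t)
    (h : 4 ≤ D.A s t * D.A t s) (k : ℕ) :
    ∃ c d : ℤ, 0 ≤ c ∧ 0 ≤ d ∧
      (if Even k then 2 * d ≤ -D.A t s * c else 2 * c ≤ -D.A s t * d) ∧
      D.act (D.cs.wordProd (alternatingWord s t k)) (D.simpleRoot s) =
        c • D.simpleRoot s + d • D.simpleRoot t := by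
  have h1 := D.off_diag_nonpos s t hst
  have h2 := D.off_diag_nonpos t s hst.symm
  induction k with
  | zero => exact ⟨1, 0, by simp [alternatingWord, h2]⟩
  | succ k ih =>
    obtain ⟨c, d, hc, hd, hb, he⟩ := ih
    rw [act_wordProd_alternatingWord_succ, he]
    by_cases hk : Even k
    · rw [if_pos hk] at hb
      refine ⟨c, -d - D.A t s * c, hc, by linarith, ?_, ?_⟩
      · rw [if_neg (by simpa [Nat.even_add_one] using hk)]
        nlinarith [mul_nonneg (sub_nonneg.2 h) hc, mul_nonneg (neg_nonneg.2 h1) (sub_nonneg.2 hb)]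
      · rw [if_pos hk, act_s_lin_right]
    · rw [if_neg hk] at hb
      refine ⟨-c - D.A s t * d, d, by linarith, hd, ?_, ?_⟩
      · rw [if_pos (by simpa [Nat.even_add_one] using hk)]
        nlinarith [mul_nonneg (sub_nonneg.2 h) hd, mul_nonneg (neg_nonneg.2 h2) (sub_nonneg.2 hb)]
      · rw [if_neg hk, act_s_lin_left]

/-- In a dihedral parabolic subgroup, an element whose reduced word ends in `t` and which becomes
longer by a further `s` sends `α_s` to a nonnegative combination of `α_s` and `α_t`. -/
theorem exists_act_alternatingWord {s t : I} (hst : s ≠ t) (k : ℕ)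
    (hk : D.coxeterMatrix s t = 0 ∨ k < D.coxeterMatrix s t) :
    ∃ c d : ℤ, 0 ≤ c ∧ 0 ≤ d ∧
      D.act (D.cs.wordProd (alternatingWord s t k)) (D.simpleRoot s) =
        c • D.simpleRoot s + d • D.simpleRoot t := by
  have hstart : D.act (D.cs.wordProd (alternatingWord s t 0)) (D.simpleRoot s) =
      (1 : ℤ) • D.simpleRoot s + (0 : ℤ) • D.simpleRoot t := by simp [alternatingWord]
  rcases D.cartan_pair_cases hst with h | h | h | h | h | h | ⟨h, h4⟩
  on_goal 7 =>
    obtain ⟨c, d, hc, hd, -, he⟩ := D.exists_act_alternatingWord_of_four_le hst h4 k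
    exact ⟨c, d, hc, hd, he⟩
  all_goals
    obtain ⟨hm, hp, hq⟩ := h
    have hlt : k < D.coxeterMatrix s t := by omega
    rw [hm] at hlt
    clear hk
    have e0 : Even 0 := by decide
    have e1 : ¬ Even 1 := by decide
    have e2 : Even 2 := by decide
    have e3 : ¬ Even 3 := by decide
    have e4 : Even 4 := by decide
    interval_cases k <;>
      simp only [act_wordProd_alternatingWord_succ, hstart, e0, e1, e2, e3, e4, if_true, if_false,
        act_s_lin_left, act_s_lin_right, hp, hq] <;>
      refine ⟨_, _, ?_, ?_, rfl⟩ <;> norm_num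

/-- A simple root is sent to a nonnegative root by `u` whenever `u s_i` is longer than `u`. -/
theorem act_simpleRoot_nonneg (u : D.Weyl) (s : I)
    (h : D.cs.length u < D.cs.length (u * D.s s)) : 0 ≤ D.act u (D.simpleRoot s) := by
  induction hn : D.cs.length u using Nat.strong_induction_on generalizing u s with
  | _ n ih =>
  subst hn
  by_cases hu : u = 1
  · subst hu
    rw [map_one, Module.End.one_apply, simpleRoot, Pi.single_nonneg]
    exact zero_le_one
  obtain ⟨t, ht⟩ := D.cs.exists_rightDescent_of_ne_one hu
  have hts : s ≠ t := by
    rintro rfl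
    exact lt_asymm h ht
  -- `P k`: the alternating word of length `k` ending in `t` splits off from `u` on the right,
  -- reducing the length by `k`.
  let P : ℕ → Prop := fun k => ∃ v : D.Weyl,
    u = v * D.cs.wordProd (alternatingWord s t k) ∧ D.cs.length v + k = D.cs.length u
  have hP0 : P 0 := ⟨u, by simp [alternatingWord], rfl⟩
  have hP1 : P 1 := by
    refine ⟨u * D.s t, ?_, D.cs.isRightDescent_iff.mp ht⟩
    simp only [alternatingWord, List.concat_eq_append, List.nil_append,
      CoxeterSystem.wordProd_singleton]
    exact (D.cs.simple_mul_simple_cancel_right t).symm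
  have hex : ∃ k, ¬ P (k + 1) := by
    refine ⟨D.cs.length u, ?_⟩
    rintro ⟨v, -, hv⟩
    omega
  classical
  obtain ⟨k, hk, hmin⟩ : ∃ k, ¬ P (k + 1) ∧ ∀ l ≤ k, P l := by
    refine ⟨Nat.find hex, Nat.find_spec hex, fun l hl => ?_⟩
    cases l with
    | zero => exact hP0
    | succ l => exact not_not.mp (Nat.find_min hex (Nat.lt_of_succ_le hl))
  have hk1 : 1 ≤ k := by
    by_contra hk0
    obtain rfl : k = 0 := by omega
    exact hk hP1
  -- The alternating suffix is shorter than the braid word, as otherwise `u` could end in `s`.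
  have hkm : D.coxeterMatrix s t = 0 ∨ k < D.coxeterMatrix s t := by
    by_contra! hcon
    obtain ⟨hm0, hmk⟩ := hcon
    obtain ⟨v, hv, hvl⟩ := hmin _ hmk
    obtain ⟨m, hm⟩ := Nat.exists_eq_succ_of_ne_zero hm0
    have hb := D.wordProd_braid s t
    rw [hm, CoxeterSystem.alternatingWord_succ t s, CoxeterSystem.wordProd_concat] at hb
    have hus : u * D.s s = v * D.cs.wordProd (alternatingWord s t m) := by
      rw [hv, hm, hb, ← mul_assoc]
      exact D.cs.simple_mul_simple_cancel_right s
    have h3 := D.cs.length_mul_le v (D.cs.wordProd (alternatingWord s t m))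
    have h4 := D.cs.length_wordProd_le (alternatingWord s t m)
    rw [CoxeterSystem.length_alternatingWord] at h4
    rw [← hus] at h3
    omega
  obtain ⟨v, hv, hvl⟩ := hmin k le_rfl
  -- Right multiplication of `v` by `s` or `t` increases its length.
  have hup : ∀ x, x = s ∨ x = t → D.cs.length v < D.cs.length (v * D.s x) := by
    intro x hx
    by_contra hdesc
    have hdesc' : D.cs.length (v * D.s x) + 1 = D.cs.length v := by
      rcases D.cs.length_mul_simple v x with h' | h'
      · exact absurd (h' ▸ Nat.lt_succ_self _) hdesc
      · exact h'
    have hvx : v = v * D.s x * D.s x := (D.cs.simple_mul_simple_cancel_right x).symm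
    by_cases hy : x = if Even k then t else s
    -- If `x` prolongs the alternating suffix, a descent contradicts the maximality of `k`.
    · refine hk ⟨v * D.s x, ?_, by omega⟩
      rw [CoxeterSystem.alternatingWord_succ', ← hy, CoxeterSystem.wordProd_cons, ← mul_assoc]
      exact hv.trans (congrArg (· * _) hvx)
    -- Otherwise `x` is the first letter of the suffix, and would cancel against `v`.
    · obtain ⟨l, rfl⟩ : ∃ l, k = l + 1 := ⟨k - 1, by omega⟩
      have hxl : x = if Even l then t else s := by
        by_cases hl : Even l <;> simp [Nat.even_add_one, hl] at hy ⊢ <;> tauto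
      have hul : u = v * D.s x * D.cs.wordProd (alternatingWord s t l) := by
        rw [hv, CoxeterSystem.alternatingWord_succ', ← hxl, CoxeterSystem.wordProd_cons, mul_assoc]
        rfl
      have h3 := D.cs.length_mul_le (v * D.s x) (D.cs.wordProd (alternatingWord s t l))
      have h4 := D.cs.length_wordProd_le (alternatingWord s t l)
      rw [CoxeterSystem.length_alternatingWord] at h4
      rw [← hul] at h3
      omega
  obtain ⟨c, d, hc, hd, he⟩ := D.exists_act_alternatingWord hts k hkm
  rw [hv, map_mul, Module.End.mul_apply, he, map_add, map_smul, map_smul]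
  have hs := ih _ (by omega) v s (hup s (Or.inl rfl)) rfl
  have ht := ih _ (by omega) v t (hup t (Or.inr rfl)) rfl
  exact add_nonneg (smul_nonneg hc hs) (smul_nonneg hd ht)

theorem act_simpleRoot_ne_zero (u : D.Weyl) (i : I) : D.act u (D.simpleRoot i) ≠ 0 := by
  intro h
  have h1 : D.act u⁻¹ (D.act u (D.simpleRoot i)) = D.simpleRoot i := by
    rw [← Module.End.mul_apply, ← map_mul, inv_mul_cancel, map_one, Module.End.one_apply]
  rw [h, map_zero] at h1
  simpa [simpleRoot] using congrFun h1 i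

/-- The sign convention for crossings makes the root of every step, forward or backward, equal to
`u · α_i`. -/
theorem AlcoveWalk.crossing_eq {D : AffineCartanDatum I} (γ : D.AlcoveWalk) (j : Fin γ.len) :
    γ.crossing j = D.act (γ.alcove j.castSucc) (D.simpleRoot (γ.panel j)) := by
  unfold AlcoveWalk.crossing
  rw [γ.step j]
  split_ifs with h
  · rw [rootPos, if_pos (D.act_simpleRoot_nonneg _ _ h)]
  · set u := γ.alcove j.castSucc
    set i := γ.panel j
    have hlt : D.cs.length (u * D.s i) < D.cs.length (u * D.s i * D.s i) := by
      have h2 : u * D.s i * D.s i = u := D.cs.simple_mul_simple_cancel_right i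
      rw [h2]
      exact lt_of_le_of_ne (not_lt.mp h) (D.cs.length_mul_simple_ne u i)
    have hneg := D.act_simpleRoot_nonneg _ _ hlt
    rw [act_mul_s_simpleRoot_self] at hneg
    rw [rootNeg, rootPos, if_neg, neg_neg]
    intro hpos
    exact D.act_simpleRoot_ne_zero u i (le_antisymm (neg_nonneg.mp hneg) hpos)

end Positivity
end AffineCartanDatum

/-! ### Yang-Baxter equations for square-zero elements -/

section YangBaxter

theorem pow_mul_eq_one_of_braid {G : Type*} [Monoid G] {a b : G} (ha : a * a = 1) (hb : b * b = 1) :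
    (a * b = b * a → (a * b) ^ 2 = 1) ∧
    (a * (b * a) = b * (a * b) → (a * b) ^ 3 = 1) ∧
    (a * (b * (a * b)) = b * (a * (b * a)) → (a * b) ^ 4 = 1) ∧
    (a * (b * (a * (b * (a * b)))) = b * (a * (b * (a * (b * a)))) → (a * b) ^ 6 = 1) := by
  have ha' : ∀ c, a * (a * c) = c := fun c => by rw [← mul_assoc, ha, one_mul]
  have hb' : ∀ c, b * (b * c) = c := fun c => by rw [← mul_assoc, hb, one_mul]
  refine ⟨fun h => ?_, fun h => ?_, fun h => ?_, fun h => ?_⟩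
  · calc (a * b) ^ 2 = (a * b) * (a * b) := by simp only [pow_succ, pow_zero, one_mul]
      _ = (b * a) * (a * b) := by rw [h]
      _ = 1 := by simp only [mul_assoc, ha', hb]
  · calc (a * b) ^ 3 = (a * (b * a)) * (b * (a * b)) := by
          simp only [pow_succ, pow_zero, one_mul, mul_assoc]
      _ = (b * (a * b)) * (b * (a * b)) := by rw [h]
      _ = 1 := by simp only [mul_assoc, ha', hb', hb]
  · calc (a * b) ^ 4 = (a * (b * (a * b))) * (a * (b * (a * b))) := by
          simp only [pow_succ, pow_zero, one_mul, mul_assoc]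
      _ = (b * (a * (b * a))) * (a * (b * (a * b))) := by rw [h]
      _ = 1 := by simp only [mul_assoc, ha', hb', hb]
  · calc (a * b) ^ 6 = (a * (b * (a * (b * (a * b))))) * (a * (b * (a * (b * (a * b))))) := by
          simp only [pow_succ, pow_zero, one_mul, mul_assoc]
      _ = (b * (a * (b * (a * (b * a))))) * (a * (b * (a * (b * (a * b))))) := by rw [h]
      _ = 1 := by simp only [mul_assoc, ha', hb', hb]

variable {R E : Type*} [CommRing R] [Ring E] [Algebra R E] {a b : E}

/-- The Yang-Baxter equation of type `A_1 × A_1`. -/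
theorem yangBaxter_two (hab : a * b = b * a) (x y : R) :
    (1 + x • a) * (1 + y • b) = (1 + y • b) * (1 + x • a) := by
  simp only [mul_add, add_mul, mul_one, one_mul, smul_mul_smul_comm, hab]
  module

/-- The Yang-Baxter equation of type `A_2`; the scalars `x, x + y, y` are its positive roots in
a reflection order. -/
theorem yangBaxter_three (ha : a * a = 0) (hb : b * b = 0)
    (hab : a * (b * a) = b * (a * b)) (x y : R) :
    (1 + x • a) * ((1 + (x + y) • b) * (1 + y • a)) =
      (1 + y • b) * ((1 + (x + y) • a) * (1 + x • b)) := by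
  simp only [mul_add, add_mul, mul_one, one_mul, smul_mul_assoc, mul_smul_comm, ha, hb, hab,
    smul_zero]
  module

/-- The Yang-Baxter equation of type `B_2`; the scalars `x, x + y, x + 2y, y` are its positive
roots in a reflection order. -/
theorem yangBaxter_four (ha : a * a = 0) (hb : b * b = 0)
    (hab : a * (b * (a * b)) = b * (a * (b * a))) (x y : R) :
    (1 + x • a) * ((1 + (x + y) • b) * ((1 + (x + 2 * y) • a) * (1 + y • b))) =
      (1 + y • b) * ((1 + (x + 2 * y) • a) * ((1 + (x + y) • b) * (1 + x • a))) := by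
  have ha' : ∀ c, a * (a * c) = 0 := fun c => by rw [← mul_assoc, ha, zero_mul]
  have hb' : ∀ c, b * (b * c) = 0 := fun c => by rw [← mul_assoc, hb, zero_mul]
  simp only [mul_add, add_mul, mul_one, one_mul, smul_mul_assoc, mul_smul_comm, ha, hb, hab,
    ha', hb', smul_zero, add_zero]
  module

/-- The Yang-Baxter equation of type `G_2`; the scalars
`x, x + y, 2x + 3y, x + 2y, x + 3y, y` are its positive roots in a reflection order. -/
theorem yangBaxter_six (ha : a * a = 0) (hb : b * b = 0)
    (hab : a * (b * (a * (b * (a * b)))) = b * (a * (b * (a * (b * a))))) (x y : R) :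
    (1 + x • a) * ((1 + (x + y) • b) * ((1 + (2 * x + 3 * y) • a) *
      ((1 + (x + 2 * y) • b) * ((1 + (x + 3 * y) • a) * (1 + y • b))))) =
    (1 + y • b) * ((1 + (x + 3 * y) • a) * ((1 + (x + 2 * y) • b) *
      ((1 + (2 * x + 3 * y) • a) * ((1 + (x + y) • b) * (1 + x • a))))) := by
  have ha' : ∀ c, a * (a * c) = 0 := fun c => by rw [← mul_assoc, ha, zero_mul]
  have hb' : ∀ c, b * (b * c) = 0 := fun c => by rw [← mul_assoc, hb, zero_mul]
  simp only [mul_add, add_mul, mul_one, one_mul, smul_mul_assoc, mul_smul_comm, ha, hb, hab,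
    ha', hb', smul_zero, add_zero]
  module

end YangBaxter

namespace AffineCartanDatum

/-! ### Linear forms of affine roots and the nil-Coxeter operators -/

section RootPoly

variable {I : Type*} [Fintype I]

theorem rootPoly_add (β γ : I → ℤ) : rootPoly (β + γ) = rootPoly β + rootPoly γ := by
  simp [rootPoly, add_mul, Finset.sum_add_distrib]

theorem rootPoly_smul (n : ℤ) (β : I → ℤ) : rootPoly (n • β) = n • rootPoly β := by
  simp [rootPoly, mul_assoc, Finset.mul_sum]

theorem rootPoly_sub_smul (β γ : I → ℤ) (n : ℤ) :
    rootPoly (β - n • γ) = rootPoly β - n • rootPoly γ := by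
  rw [sub_eq_add_neg, ← neg_smul, rootPoly_add, rootPoly_smul, neg_smul, sub_eq_add_neg]

end RootPoly

section Operators

variable {I : Type*} [Fintype I] [DecidableEq I] (D : AffineCartanDatum I)

open CoxeterSystem (alternatingWord)

/-- The linear form of the affine root `u · α_i`. -/
noncomputable def rootForm (u : D.Weyl) (i : I) : MvPolynomial I ℤ :=
  rootPoly (D.act u (D.simpleRoot i))

theorem rootForm_mul_s (u : D.Weyl) (i j : I) :
    D.rootForm (u * D.s i) j = D.rootForm u j - D.A i j • D.rootForm u i := by
  rw [rootForm, act_mul_s_simpleRoot, rootPoly_sub_smul]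
  rfl

theorem rootForm_mul_s_self (u : D.Weyl) (i : I) :
    D.rootForm (u * D.s i) i = -D.rootForm u i := by
  rw [rootForm_mul_s, D.diag]
  module

/-- Right multiplication by the generator `x_i` of the nil-Coxeter algebra, where
`x_v x_i` is `x_{v s_i}` if `v s_i` is longer than `v`, and `0` otherwise. A function
`φ : W_af → ℤ[α_i]` stands for the (possibly infinite) combination `∑ φ(v) x_v`. -/
noncomputable def nilOp (i : I) :
    Module.End (MvPolynomial I ℤ) (D.Weyl → MvPolynomial I ℤ) where
  toFun φ v := if D.cs.length (v * D.s i) + 1 = D.cs.length v then φ (v * D.s i) else 0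
  map_add' φ φ' := by
    funext v
    by_cases h : D.cs.length (v * D.s i) + 1 = D.cs.length v <;> simp [h]
  map_smul' c φ := by
    funext v
    by_cases h : D.cs.length (v * D.s i) + 1 = D.cs.length v <;> simp [h]

theorem nilOp_apply (i : I) (φ : D.Weyl → MvPolynomial I ℤ) (v : D.Weyl) :
    D.nilOp i φ v =
      if D.cs.length (v * D.s i) + 1 = D.cs.length v then φ (v * D.s i) else 0 := rfl

/-- A word acts by a single shift if `v` has a reduced word ending in the reversal of that
word, and by zero otherwise. The result depends only on the product and the length of the word,
which gives the nil-Coxeter relations. -/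
theorem prod_map_nilOp_apply (ω : List I) (φ : D.Weyl → MvPolynomial I ℤ) (v : D.Weyl) :
    (ω.map D.nilOp).prod φ v =
      if D.cs.length (v * D.cs.wordProd ω) + ω.length = D.cs.length v then
        φ (v * D.cs.wordProd ω) else 0 := by
  induction ω generalizing v with
  | nil => simp
  | cons i ω ih =>
    rw [List.map_cons, List.prod_cons, Module.End.mul_apply, nilOp_apply, ih,
      CoxeterSystem.wordProd_cons, ← mul_assoc, List.length_cons]
    change (if _ then (if _ then _ else _) else _) = if D.cs.length (v * D.s i * _) + _ = _
      then φ (v * D.s i * _) else _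
    have h1 := D.cs.length_mul_simple v i
    have h2 := D.cs.length_le_length_mul_add_right (v * D.s i) (D.cs.wordProd ω)
    have h3 := D.cs.length_wordProd_le ω
    change D.cs.length (v * D.s i) = _ ∨ D.cs.length (v * D.s i) + 1 = _ at h1
    split_ifs <;> first | rfl | omega

theorem nilOp_mul_self (i : I) : D.nilOp i * D.nilOp i = 0 := by
  refine LinearMap.ext fun φ => funext fun v => ?_
  have h := D.prod_map_nilOp_apply [i, i] φ v
  have h1 : D.cs.wordProd [i, i] = 1 := by
    rw [CoxeterSystem.wordProd_cons, CoxeterSystem.wordProd_singleton,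
      D.cs.simple_mul_simple_self]
  rw [h1] at h
  simpa using h

theorem nilOp_braid (i j : I) :
    ((alternatingWord i j (D.coxeterMatrix i j)).map D.nilOp).prod =
      ((alternatingWord j i (D.coxeterMatrix i j)).map D.nilOp).prod := by
  refine LinearMap.ext fun φ => funext fun v => ?_
  simp only [prod_map_nilOp_apply, D.wordProd_braid i j, CoxeterSystem.length_alternatingWord]

/-! ### The steps of alcove walks and their braid relations -/

/-- One step of an alcove walk across a panel of type `i`, on pairs of the current alcove `u` and
the family `φ` of the mask sums so far: the new family is `φ (1 + β x_i)`, where `β = u · α_i`. -/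
noncomputable def walkStep (i : I) :
    Function.End (D.Weyl × (D.Weyl → MvPolynomial I ℤ)) :=
  fun p => (p.1 * D.s i, (1 + D.rootForm p.1 i • D.nilOp i) p.2)

theorem walkStep_mul_self (i : I) : D.walkStep i * D.walkStep i = 1 := by
  funext ⟨u, φ⟩
  refine Prod.ext (D.cs.simple_mul_simple_cancel_right i) ?_
  change ((1 + D.rootForm (u * D.s i) i • D.nilOp i) * (1 + D.rootForm u i • D.nilOp i)) φ = φ
  simp [rootForm_mul_s_self, mul_add, add_mul, nilOp_mul_self]

theorem walkStep_apply (i : I) (u : D.Weyl) (φ : D.Weyl → MvPolynomial I ℤ) :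
    D.walkStep i (u, φ) = (u * D.s i, (1 + D.rootForm u i • D.nilOp i) φ) := rfl

theorem walkStep_braid_two {i j : I} (hm : D.coxeterMatrix i j = 2) (hp : D.A i j = 0)
    (hq : D.A j i = 0) :
    D.walkStep i * D.walkStep j = D.walkStep j * D.walkStep i := by
  have hW := D.wordProd_braid i j
  have hN := D.nilOp_braid i j
  rw [hm] at hW hN
  simp only [alternatingWord, List.concat_eq_append, List.nil_append, List.cons_append,
    CoxeterSystem.wordProd, List.map_cons, List.map_nil, List.prod_cons, List.prod_nil,
    mul_one] at hW hN
  funext ⟨u, φ⟩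
  change D.walkStep i (D.walkStep j (u, φ)) = D.walkStep j (D.walkStep i (u, φ))
  simp only [walkStep_apply, rootForm_mul_s, hp, hq, zero_smul, sub_zero, mul_assoc]
  exact Prod.ext (congrArg (u * ·) hW.symm)
    (congrArg (· φ) (yangBaxter_two hN (D.rootForm u i) (D.rootForm u j)))

set_option linter.unusedSimpArgs false in
theorem walkStep_braid_three {i j : I} (hm : D.coxeterMatrix i j = 3) (hp : D.A i j = -1)
    (hq : D.A j i = -1) :
    D.walkStep i * (D.walkStep j * D.walkStep i) =
      D.walkStep j * (D.walkStep i * D.walkStep j) := by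
  have hW := D.wordProd_braid i j
  have hN := D.nilOp_braid i j
  rw [hm] at hW hN
  simp only [alternatingWord, List.concat_eq_append, List.nil_append, List.cons_append,
    CoxeterSystem.wordProd, List.map_cons, List.map_nil, List.prod_cons, List.prod_nil,
    mul_one] at hW hN
  funext ⟨u, φ⟩
  change D.walkStep i (D.walkStep j (D.walkStep i (u, φ))) =
    D.walkStep j (D.walkStep i (D.walkStep j (u, φ)))
  set x := D.rootForm u j
  set y := D.rootForm u i
  have c1 : D.rootForm (u * D.s i) j = x + y := by
    simp only [rootForm_mul_s, D.diag, hp, hq, zsmul_eq_mul]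
    push_cast
    ring
  have c2 : D.rootForm (u * D.s i * D.s j) i = x := by
    simp only [rootForm_mul_s, D.diag, hp, hq, zsmul_eq_mul]
    push_cast
    ring
  have c3 : D.rootForm (u * D.s j) i = x + y := by
    simp only [rootForm_mul_s, D.diag, hp, hq, zsmul_eq_mul]
    push_cast
    ring
  have c4 : D.rootForm (u * D.s j * D.s i) j = y := by
    simp only [rootForm_mul_s, D.diag, hp, hq, zsmul_eq_mul]
    push_cast
    ring
  simp only [walkStep_apply, c1, c2, c3, c4]
  simp only [mul_assoc]
  exact Prod.ext (congrArg (u * ·) hW.symm) (congrArg (· φ)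
    (yangBaxter_three (D.nilOp_mul_self i) (D.nilOp_mul_self j) hN.symm x y))

set_option linter.unusedSimpArgs false in
theorem walkStep_braid_four {i j : I} (hm : D.coxeterMatrix i j = 4) (hp : D.A i j = -1)
    (hq : D.A j i = -2) :
    D.walkStep i * (D.walkStep j * (D.walkStep i * D.walkStep j)) =
      D.walkStep j * (D.walkStep i * (D.walkStep j * D.walkStep i)) := by
  have hW := D.wordProd_braid i j
  have hN := D.nilOp_braid i j
  rw [hm] at hW hN
  simp only [alternatingWord, List.concat_eq_append, List.nil_append, List.cons_append,
    CoxeterSystem.wordProd, List.map_cons, List.map_nil, List.prod_cons, List.prod_nil,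
    mul_one] at hW hN
  funext ⟨u, φ⟩
  change D.walkStep i (D.walkStep j (D.walkStep i (D.walkStep j (u, φ)))) =
    D.walkStep j (D.walkStep i (D.walkStep j (D.walkStep i (u, φ))))
  set x := D.rootForm u i
  set y := D.rootForm u j
  have c1 : D.rootForm (u * D.s j) i = x + 2 * y := by
    simp only [rootForm_mul_s, D.diag, hp, hq, zsmul_eq_mul]
    push_cast
    ring
  have c2 : D.rootForm (u * D.s j * D.s i) j = x + y := by
    simp only [rootForm_mul_s, D.diag, hp, hq, zsmul_eq_mul]
    push_cast
    ring
  have c3 : D.rootForm (u * D.s j * D.s i * D.s j) i = x := by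
    simp only [rootForm_mul_s, D.diag, hp, hq, zsmul_eq_mul]
    push_cast
    ring
  have c4 : D.rootForm (u * D.s i) j = x + y := by
    simp only [rootForm_mul_s, D.diag, hp, hq, zsmul_eq_mul]
    push_cast
    ring
  have c5 : D.rootForm (u * D.s i * D.s j) i = x + 2 * y := by
    simp only [rootForm_mul_s, D.diag, hp, hq, zsmul_eq_mul]
    push_cast
    ring
  have c6 : D.rootForm (u * D.s i * D.s j * D.s i) j = y := by
    simp only [rootForm_mul_s, D.diag, hp, hq, zsmul_eq_mul]
    push_cast
    ring
  simp only [walkStep_apply, c1, c2, c3, c4, c5, c6]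
  simp only [mul_assoc]
  exact Prod.ext (congrArg (u * ·) hW.symm) (congrArg (· φ)
    (yangBaxter_four (D.nilOp_mul_self i) (D.nilOp_mul_self j) hN x y))

set_option linter.unusedSimpArgs false in
theorem walkStep_braid_six {i j : I} (hm : D.coxeterMatrix i j = 6) (hp : D.A i j = -1)
    (hq : D.A j i = -3) :
    D.walkStep i * (D.walkStep j * (D.walkStep i * (D.walkStep j *
      (D.walkStep i * D.walkStep j)))) =
    D.walkStep j * (D.walkStep i * (D.walkStep j * (D.walkStep i *
      (D.walkStep j * D.walkStep i)))) := by
  have hW := D.wordProd_braid i j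
  have hN := D.nilOp_braid i j
  rw [hm] at hW hN
  simp only [alternatingWord, List.concat_eq_append, List.nil_append, List.cons_append,
    CoxeterSystem.wordProd, List.map_cons, List.map_nil, List.prod_cons, List.prod_nil,
    mul_one] at hW hN
  funext ⟨u, φ⟩
  change D.walkStep i (D.walkStep j (D.walkStep i (D.walkStep j (D.walkStep i
      (D.walkStep j (u, φ)))))) =
    D.walkStep j (D.walkStep i (D.walkStep j (D.walkStep i (D.walkStep j
      (D.walkStep i (u, φ))))))
  set x := D.rootForm u i
  set y := D.rootForm u j
  have c1 : D.rootForm (u * D.s j) i = x + 3 * y := by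
    simp only [rootForm_mul_s, D.diag, hp, hq, zsmul_eq_mul]
    push_cast
    ring
  have c2 : D.rootForm (u * D.s j * D.s i) j = x + 2 * y := by
    simp only [rootForm_mul_s, D.diag, hp, hq, zsmul_eq_mul]
    push_cast
    ring
  have c3 : D.rootForm (u * D.s j * D.s i * D.s j) i = 2 * x + 3 * y := by
    simp only [rootForm_mul_s, D.diag, hp, hq, zsmul_eq_mul]
    push_cast
    ring
  have c4 : D.rootForm (u * D.s j * D.s i * D.s j * D.s i) j = x + y := by
    simp only [rootForm_mul_s, D.diag, hp, hq, zsmul_eq_mul]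
    push_cast
    ring
  have c5 : D.rootForm (u * D.s j * D.s i * D.s j * D.s i * D.s j) i = x := by
    simp only [rootForm_mul_s, D.diag, hp, hq, zsmul_eq_mul]
    push_cast
    ring
  have c6 : D.rootForm (u * D.s i) j = x + y := by
    simp only [rootForm_mul_s, D.diag, hp, hq, zsmul_eq_mul]
    push_cast
    ring
  have c7 : D.rootForm (u * D.s i * D.s j) i = 2 * x + 3 * y := by
    simp only [rootForm_mul_s, D.diag, hp, hq, zsmul_eq_mul]
    push_cast
    ring
  have c8 : D.rootForm (u * D.s i * D.s j * D.s i) j = x + 2 * y := by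
    simp only [rootForm_mul_s, D.diag, hp, hq, zsmul_eq_mul]
    push_cast
    ring
  have c9 : D.rootForm (u * D.s i * D.s j * D.s i * D.s j) i = x + 3 * y := by
    simp only [rootForm_mul_s, D.diag, hp, hq, zsmul_eq_mul]
    push_cast
    ring
  have c10 : D.rootForm (u * D.s i * D.s j * D.s i * D.s j * D.s i) j = y := by
    simp only [rootForm_mul_s, D.diag, hp, hq, zsmul_eq_mul]
    push_cast
    ring
  simp only [walkStep_apply, c1, c2, c3, c4, c5, c6, c7, c8, c9, c10]
  simp only [mul_assoc]
  exact Prod.ext (congrArg (u * ·) hW.symm) (congrArg (· φ)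
    (yangBaxter_six (D.nilOp_mul_self i) (D.nilOp_mul_self j) hN x y))

end Operators

/-! ### Independence of the walk -/

section Independence

variable {I : Type*} [Fintype I] [DecidableEq I] (D : AffineCartanDatum I)

theorem walkStep_isLiftable : D.coxeterMatrix.IsLiftable D.walkStep := by
  intro i j
  by_cases hij : i = j
  · subst hij
    rw [walkStep_mul_self, one_pow]
  have H := pow_mul_eq_one_of_braid (D.walkStep_mul_self i) (D.walkStep_mul_self j)
  have hsymm := D.coxeterMatrix.symmetric i j
  rcases D.cartan_pair_cases hij with ⟨hm, hp, hq⟩ | ⟨hm, hp, hq⟩ | ⟨hm, hp, hq⟩ | ⟨hm, hp, hq⟩ |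
    ⟨hm, hp, hq⟩ | ⟨hm, hp, hq⟩ | ⟨hm, -⟩
  · rw [hm]
    exact H.1 (D.walkStep_braid_two hm hp hq)
  · rw [hm]
    exact H.2.1 (D.walkStep_braid_three hm hp hq)
  · rw [hm]
    exact H.2.2.1 (D.walkStep_braid_four hm hp hq)
  · rw [hm]
    exact H.2.2.1 (D.walkStep_braid_four (hsymm ▸ hm) hq hp).symm
  · rw [hm]
    exact H.2.2.2 (D.walkStep_braid_six hm hp hq)
  · rw [hm]
    exact H.2.2.2 (D.walkStep_braid_six (hsymm ▸ hm) hq hp).symm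
  · rw [hm, pow_zero]

/-- The action of `W_af` by alcove walks: `w` performs the steps of a word for `w` from right to
left, so that the walk to `w` from the base alcove is performed by `w⁻¹`. -/
noncomputable def walkAction :
    D.Weyl →* Function.End (D.Weyl × (D.Weyl → MvPolynomial I ℤ)) :=
  D.cs.lift ⟨D.walkStep, D.walkStep_isLiftable⟩

theorem walkAction_s (i : I) : D.walkAction (D.s i) = D.walkStep i :=
  D.cs.lift_apply_simple D.walkStep_isLiftable i

theorem walkAction_mul_apply (x y : D.Weyl) (p : D.Weyl × (D.Weyl → MvPolynomial I ℤ)) :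
    D.walkAction (x * y) p = D.walkAction x (D.walkAction y p) := by
  rw [map_mul]
  rfl

theorem walkAction_one_apply (p : D.Weyl × (D.Weyl → MvPolynomial I ℤ)) :
    D.walkAction 1 p = p := by
  rw [map_one]
  rfl

theorem s_inv (i : I) : (D.s i)⁻¹ = D.s i := D.cs.inv_simple i

/-- Induction over the elements of `W_af` by left multiplication with simple reflections. -/
theorem weyl_induction {p : D.Weyl → Prop} (w : D.Weyl) (one : p 1)
    (mul : ∀ w i, p w → p (D.s i * w)) : p w :=
  D.cs.simple_induction_left w one mul

theorem walkAction_fst (w : D.Weyl) (p : D.Weyl × (D.Weyl → MvPolynomial I ℤ)) :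
    (D.walkAction w p).1 = p.1 * w⁻¹ := by
  induction w using D.weyl_induction with
  | one => rw [walkAction_one_apply, inv_one, mul_one]
  | mul w i ih =>
    rw [walkAction_mul_apply, walkAction_s, mul_inv_rev, s_inv, ← mul_assoc, ← ih]
    rfl

open Classical in
/-- The start of every walk: the base alcove, with the unit `x_1` of the nil-Coxeter algebra. -/
noncomputable def walkStart : D.Weyl × (D.Weyl → MvPolynomial I ℤ) := (1, Pi.single 1 1)

/-- The family of mask sums of the walks from the base alcove to `w`, as produced by the action of
`W_af`; it depends on `w` only. -/
noncomputable def walkCoeff (w : D.Weyl) : D.Weyl → MvPolynomial I ℤ :=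
  (D.walkAction w⁻¹ D.walkStart).2

theorem walkAction_inv_walkStart (w : D.Weyl) :
    D.walkAction w⁻¹ D.walkStart = (w, D.walkCoeff w) := by
  refine Prod.ext ?_ rfl
  rw [walkAction_fst, inv_inv]
  exact one_mul w

open Classical in
theorem walkCoeff_one : D.walkCoeff 1 = Pi.single 1 1 := by
  rw [walkCoeff, inv_one, walkAction_one_apply]
  rfl

theorem walkCoeff_mul_s (w : D.Weyl) (i : I) :
    D.walkCoeff (w * D.s i) = (1 + D.rootForm w i • D.nilOp i) (D.walkCoeff w) := by
  rw [walkCoeff, mul_inv_rev, s_inv, walkAction_mul_apply, walkAction_s,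
    walkAction_inv_walkStart, walkStep_apply]

/-! ### The GKM condition -/

/-- The reflection in `β = r · α_i` moves lattice elements by multiples of `β`. -/
theorem act_reflection (r : D.Weyl) (i : I) (μ : I → ℤ) :
    ∃ n : ℤ, D.act (r * D.s i * r⁻¹) μ = μ - n • D.act r (D.simpleRoot i) := by
  refine ⟨D.corootPairing i (D.act r⁻¹ μ), ?_⟩
  have h : D.act r (D.act r⁻¹ μ) = μ := by
    rw [← Module.End.mul_apply, ← map_mul, mul_inv_cancel, map_one, Module.End.one_apply]
  rw [map_mul, map_mul, Module.End.mul_apply, Module.End.mul_apply, act_s, map_sub, map_smul, h]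

/-- Modulo the linear form of `β = r · α_i`, a step taken from an alcove and the same step taken
from its mirror image under `s_β` have the same effect; hence so have walks. -/
theorem dvd_walkAction_sub (r : D.Weyl) (i : I) (x : D.Weyl)
    (p p' : D.Weyl × (D.Weyl → MvPolynomial I ℤ)) (h1 : p'.1 = r * D.s i * r⁻¹ * p.1)
    (h2 : ∀ v, D.rootForm r i ∣ p.2 v - p'.2 v) (v : D.Weyl) :
    D.rootForm r i ∣ (D.walkAction x p).2 v - (D.walkAction x p').2 v := by
  induction x using D.weyl_induction generalizing v with
  | one =>
    rw [walkAction_one_apply, walkAction_one_apply]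
    exact h2 v
  | mul x j ih =>
    rw [walkAction_mul_apply, walkAction_mul_apply, walkAction_s]
    have hu : (D.walkAction x p').1 = r * D.s i * r⁻¹ * (D.walkAction x p).1 := by
      rw [walkAction_fst, walkAction_fst, h1, mul_assoc]
    generalize D.walkAction x p = P at hu ih ⊢
    generalize D.walkAction x p' = P' at hu ih ⊢
    obtain ⟨u, φ⟩ := P
    obtain ⟨u', φ'⟩ := P'
    obtain rfl : u' = r * D.s i * r⁻¹ * u := hu
    obtain ⟨n, hn⟩ := D.act_reflection r i (D.act u (D.simpleRoot j))
    have hroot : D.rootForm (r * D.s i * r⁻¹ * u) j = D.rootForm u j - n • D.rootForm r i := by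
      rw [rootForm, map_mul _ _ u, Module.End.mul_apply, hn, rootPoly_sub_smul]
      rfl
    have hnil : D.rootForm r i ∣ D.nilOp j φ v - D.nilOp j φ' v := by
      rw [nilOp_apply, nilOp_apply]
      split_ifs
      · exact ih _
      · simp
    simp only [walkStep_apply, hroot, LinearMap.add_apply, LinearMap.smul_apply,
      Module.End.one_apply, Pi.add_apply, Pi.smul_apply, smul_eq_mul]
    obtain ⟨a, ha⟩ := ih v
    obtain ⟨b, hb⟩ := hnil
    refine ⟨a + D.rootForm u j * b + n • D.nilOp j φ' v, ?_⟩
    simp only [zsmul_eq_mul]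
    linear_combination ha + D.rootForm u j * hb

theorem satisfiesGKM_walkCoeff (v : D.Weyl) : D.SatisfiesGKM fun w => D.walkCoeff w v := by
  rintro β - t ⟨r, i, rfl, rfl⟩ w
  have e1 : w⁻¹ = w⁻¹ * r * r⁻¹ := by rw [mul_inv_cancel_right]
  have e2 : (r * D.s i * r⁻¹ * w)⁻¹ = w⁻¹ * r * (r * D.s i)⁻¹ := by
    simp only [mul_inv_rev, inv_inv, mul_assoc]
  have h1 : D.walkCoeff w v = (D.walkAction (w⁻¹ * r) (r, D.walkCoeff r)).2 v := by
    rw [← walkAction_inv_walkStart, ← walkAction_mul_apply, ← e1]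
    rfl
  have h2 : D.walkCoeff (r * D.s i * r⁻¹ * w) v =
      (D.walkAction (w⁻¹ * r) (r * D.s i, D.walkCoeff (r * D.s i))).2 v := by
    rw [← walkAction_inv_walkStart, ← walkAction_mul_apply, ← e2]
    rfl
  change D.rootForm r i ∣ D.walkCoeff w v - D.walkCoeff (r * D.s i * r⁻¹ * w) v
  rw [h1, h2]
  refine D.dvd_walkAction_sub r i _ _ _ (inv_mul_cancel_right _ _).symm (fun v => ?_) v
  change D.rootForm r i ∣ D.walkCoeff r v - D.walkCoeff (r * D.s i) v
  rw [walkCoeff_mul_s]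
  exact ⟨-D.nilOp i (D.walkCoeff r) v, by simp⟩

end Independence

/-! ### Mask sums as nil-Coxeter coefficients -/

section Masks

variable {I : Type*} [Fintype I] [DecidableEq I] (D : AffineCartanDatum I)

open Classical in
/-- The mask sums for panel types `p`, as a function of `v`, with arbitrary polynomials `b j` in
place of the crossing roots. -/
noncomputable def weightedMaskSum {n : ℕ} (p : Fin n → I) (b : Fin n → MvPolynomial I ℤ) :
    D.Weyl → MvPolynomial I ℤ := fun v =>
  ∑ ε : Fin n → Fin 2,
    if (∑ j, (ε j : ℕ)) = D.cs.length v ∧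
      (List.ofFn fun j => D.s (p j) ^ (ε j : ℕ)).prod = v then ∏ j, b j ^ (ε j : ℕ) else 0

theorem AlcoveWalk.maskSum_eq_weightedMaskSum {D : AffineCartanDatum I} (γ : D.AlcoveWalk)
    (v : D.Weyl) :
    γ.maskSum v = D.weightedMaskSum γ.panel (fun j => rootPoly (γ.crossing j)) v := by
  classical
  have hval : ∀ e : Fin 2, (e : ℕ) = if e = 1 then 1 else 0 := by decide
  rw [AlcoveWalk.maskSum, weightedMaskSum, Finset.sum_filter]
  refine Finset.sum_congr rfl fun ε _ => ?_
  have h1 : γ.support ε = ∑ j, (ε j : ℕ) := by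
    rw [AlcoveWalk.support, Finset.card_filter]
    exact Finset.sum_congr rfl fun j _ => (hval (ε j)).symm
  have h2 : γ.Psi ε = ∏ j, rootPoly (γ.crossing j) ^ (ε j : ℕ) := by
    rw [AlcoveWalk.Psi, Finset.prod_filter]
    refine Finset.prod_congr rfl fun j _ => ?_
    rw [hval (ε j)]
    split_ifs <;> simp
  rw [h1, h2]
  rfl

theorem length_subexpr_le {n : ℕ} (p : Fin n → I) (ε : Fin n → Fin 2) :
    D.cs.length (List.ofFn fun j => D.s (p j) ^ (ε j : ℕ)).prod ≤ ∑ j, (ε j : ℕ) := by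
  induction n with
  | zero => simp
  | succ n ih =>
    rw [List.ofFn_succ, List.prod_cons, Fin.sum_univ_succ]
    refine (D.cs.length_mul_le _ _).trans (add_le_add ?_ (ih _ _))
    have h : ∀ e : Fin 2, e = 0 ∨ e = 1 := by decide
    rcases h (ε 0) with h | h <;> rw [h]
    · simp
    · rw [Fin.val_one, pow_one]
      exact (D.cs.length_simple (p 0)).le

/-- Masks that omit the last step contribute the mask sum of the shortened walk; those that use it
contribute its product with the generator of the nil-Coxeter algebra. -/
theorem weightedMaskSum_succ {n : ℕ} (p : Fin (n + 1) → I) (b : Fin (n + 1) → MvPolynomial I ℤ) :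
    D.weightedMaskSum p b =
      (1 + b (Fin.last n) • D.nilOp (p (Fin.last n)))
        (D.weightedMaskSum (fun j => p j.castSucc) (fun j => b j.castSucc)) := by
  classical
  funext v
  set i := p (Fin.last n)
  simp only [LinearMap.add_apply, LinearMap.smul_apply,
    Module.End.one_apply, Pi.add_apply, Pi.smul_apply, smul_eq_mul, nilOp_apply]
  rw [weightedMaskSum, ← (Fin.snocEquiv (fun _ : Fin (n + 1) => Fin 2)).sum_comp,
    Fintype.sum_prod_type, Fin.sum_univ_two]
  simp only [Fin.snocEquiv, Equiv.coe_fn_mk, Fin.sum_univ_castSucc, Fin.prod_univ_castSucc,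
    Fin.snoc_castSucc, Fin.snoc_last, List.ofFn_succ', List.concat_eq_append, List.prod_append,
    List.prod_singleton, Fin.val_zero, Fin.val_one, pow_zero, pow_one, mul_one, add_zero]
  congr 1
  change (∑ ε : Fin n → Fin 2, if _ ∧ _ * D.s i = v then _ else 0) = _
  split_ifs with hv
  · rw [weightedMaskSum, Finset.mul_sum]
    refine Finset.sum_congr rfl fun ε _ => ?_
    rw [mul_ite, mul_zero, mul_comm (b _)]
    refine if_congr ?_ rfl rfl
    rw [← hv, add_left_inj, ← eq_mul_inv_iff_mul_eq, s_inv]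
  · rw [mul_zero]
    refine Finset.sum_eq_zero fun ε _ => if_neg ?_
    rintro ⟨hsum, rfl⟩
    -- A reduced mask for `v = x s_i` that uses the last step leaves a mask for `x` with
    -- `ℓ(v) - 1` entries, which is at least `ℓ(x)`.
    set x := (List.ofFn fun j : Fin n => D.s (p j.castSucc) ^ (ε j : ℕ)).prod with hx
    have hle : D.cs.length x ≤ ∑ j, (ε j : ℕ) := D.length_subexpr_le (fun j => p j.castSucc) ε
    have hxx : x * D.s i * D.s i = x := D.cs.simple_mul_simple_cancel_right i
    have hlen := D.cs.length_mul_simple x i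
    change D.cs.length (x * D.s i) = _ ∨ D.cs.length (x * D.s i) + 1 = _ at hlen
    rw [hxx] at hv
    omega

/-- The mask sums of a walk are the coefficients attached to its end alcove. -/
theorem weightedMaskSum_eq_walkCoeff {n : ℕ} (p : Fin n → I) (a : Fin (n + 1) → D.Weyl)
    (h0 : a 0 = 1) (hs : ∀ j : Fin n, a j.succ = a j.castSucc * D.s (p j)) :
    D.weightedMaskSum p (fun j => D.rootForm (a j.castSucc) (p j)) =
      D.walkCoeff (a (Fin.last n)) := by
  classical
  induction n with
  | zero =>
    change D.weightedMaskSum p _ = D.walkCoeff (a 0)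
    rw [h0, walkCoeff_one]
    funext v
    by_cases hv : v = 1
    · simp [weightedMaskSum, hv]
    · simp [weightedMaskSum, hv, Ne.symm hv]
  | succ n ih =>
    rw [weightedMaskSum_succ, ih (fun j => p j.castSucc) (fun j => a j.castSucc) h0
      (fun j => hs j.castSucc), ← Fin.succ_last, hs, walkCoeff_mul_s]

theorem AlcoveWalk.maskSum_eq_walkCoeff {D : AffineCartanDatum I} (γ : D.AlcoveWalk)
    (v : D.Weyl) : γ.maskSum v = D.walkCoeff γ.target v := by
  rw [γ.maskSum_eq_weightedMaskSum]
  simp only [γ.crossing_eq]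
  exact congrFun (D.weightedMaskSum_eq_walkCoeff γ.panel γ.alcove γ.start γ.step) v

theorem psi_eq_walkCoeff (v w : D.Weyl) : D.psi v w = D.walkCoeff w v := by
  rw [psi, AlcoveWalk.maskSum_eq_walkCoeff, (D.exists_walk w).choose_spec]

end Masks
end AffineCartanDatum

theorem theorem1 {I : Type*} [Fintype I] [DecidableEq I] (D : AffineCartanDatum I) :
    (∀ (v : D.Weyl) (γ : D.AlcoveWalk), D.psi v γ.target = γ.maskSum v) ∧
      ∀ v : D.Weyl, D.SatisfiesGKM (D.psi v) := by
  refine ⟨fun v γ => ?_, fun v => ?_⟩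
  · rw [D.psi_eq_walkCoeff, γ.maskSum_eq_walkCoeff]
  · rw [funext (D.psi_eq_walkCoeff v)]
    exact D.satisfiesGKM_walkCoeff v
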